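/- **Setting.** Let $d_C,d_S,d\ge 0$ be integers and let $n$ range over a nonempty index set $I$ of domains (for instance $I=\{1,\dots,N\}$). Let $\mathcal C\subseteq\mathbb R^{d_C}$ and $\mathcal S^{(n)}\subseteq\mathbb R^{d_S}$ ($n\in I$) be open and simply connected, and put $\mathcal S=\bigcup_n\mathcal S^{(n)}$. Let $g:\mathcal C\times\mathcal S\to\mathbb R^d$ be differentiable and injective, and put $\mathcal X=g(\mathcal C\times\mathcal S)$. For every $n$ let $(c,s^{(n)})$ be a random vector in $\mathcal C\times\mathcal S^{(n)}$ with law $\mathbb P_n$, such that the law $p_c$ of $c$ does not depend on $n$ (content and style may be dependent). The spaces are the supports of the variables: $p_c(U)>0$ for every open $U$ that meets $\mathcal C$, and $\mathbb P_n(B\times W)>0$ for all measurable $B\subseteq\mathbb R^{d_C}$ with $p_c(B)>0$ and all open $W\subseteq\mathbb R^{d_S}$ that meet $\mathcal S^{(n)}$ (both hold if $\mathbb P_n$ has a density that is positive on $\mathcal C\times\mathcal S^{(n)}$). The data in domain $n$ are $x^{(n)}=g(c,s^{(n)})$. Write $J_cg$ and $J_sg$ for the Jacobians of $g$ in the content and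 the style variable and $\mathcal R(\cdot)$ for the range of a matrix. **Domain variability.** For every measurable $A\subseteq\mathcal C\times\mathcal S$ such that $\mathbb P_n(A)>0$ for all $n$, and such that there is no measurable $B\subseteq\mathcal C$ for which $A$ and $B\times\mathcal S$ differ only by a $\mathbb P_n$-null set for every $n$, there are $i,j\in I$ with $\mathbb P_i(A)\ne\mathbb P_j(A)$. **Learning problem.** A solution consists of open sets $\widehat{\mathcal C}\subseteq\mathbb R^{d_C}$ and $\widehat{\mathcal S}\subseteq\mathbb R^{d_S}$, a differentiable bijection $\widehat g:\widehat{\mathcal C}\times\widehat{\mathcal S}\to\mathcal X$ whose inverse $\widehat f:\mathcal X\to\widehat{\mathcal C}\times\widehat{\mathcal S}$ is differentiable on $\mathcal X$ (that is, at every $x\in\mathcal X$ it has a first-order linear approximation along $\mathcal X$), and, for every $n$, a random vector $(\widehat c,\widehat s^{(n)})$ in $\widehat{\mathcal C}\times\widehat{\mathcal S}$, the law of $\widehat c$ not depending on $n$, such that 1. $\widehat g(\widehat c,\widehat s^{(n)})$ has the same distribution as $x^{(n)}$ for every $n$; 2. $\mathcal R\big(J_{\widehat c}\,\widehat g(\widehat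 c,\widehat s)\big)\perp\mathcal R\big(J_{\widehat s}\,\widehat g(\widehat c,\widehat s)\big)$ for all $(\widehat c,\widehat s)\in\widehat{\mathcal C}\times\widehat{\mathcal S}$. The learned content and style of a data point $x\in\mathcal X$ are the two components $\widehat f_C(x)$ and $\widehat f_S(x)$ of $\widehat f(x)$. **Theorem (Identifiability of content and style).** Assume domain variability. Then for every solution of the learning problem there is a bijection $\gamma:\mathcal C\to\widehat{\mathcal C}$ such that $$\widehat f_C\big(g(c,s)\big)=\gamma(c)\qquad\text{for all } n\in I,\ c\in\mathcal C,\ s\in\mathcal S^{(n)}.$$ If, in addition, for all $n\in I$, $c\in\mathcal C$ and $s\in\mathcal S^{(n)}$ one has $\mathcal R\big(J_cg(c,s)\big)\perp\mathcal R\big(J_sg(c,s)\big)$ (content-style differential independence) and $\operatorname{rank}J_sg(c,s)=d_S$, then there is a bijection $\delta:\mathcal S\to\widehat{\mathcal S}$, the same for all domains and independent of the content, such that $$\widehat f_S\big(g(c,s)\big)=\delta(s)\qquad\text{for all } n\in I,\ c\in\mathcal C,\ s\in\mathcal S^{(n)}.$$ -/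

import Mathlib

open MeasureTheory Set

namespace ContentStyle

/-- Euclidean space `ℝᵏ`. -/
abbrev E (k : ℕ) : Type := EuclideanSpace ℝ (Fin k)

/-- Content Jacobian `J_c g (c, s)`, as a linear map `ℝ^dC → ℝ^d`. -/
noncomputable def contentJacobian {dC dS d : ℕ} (g : E dC × E dS → E d) (c : E dC) (s : E dS) :
    E dC →L[ℝ] E d :=
  fderiv ℝ (fun c' => g (c', s)) c

/-- Style Jacobian `J_s g (c, s)`, as a linear map `ℝ^dS → ℝ^d`. -/
noncomputable def styleJacobian {dC dS d : ℕ} (g : E dC × E dS → E d) (c : E dC) (s : E dS) :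
    E dS →L[ℝ] E d :=
  fderiv ℝ (fun s' => g (c, s')) s

/-- The ranges of the content Jacobian and of the style Jacobian of `g` at `(c, s)` are
orthogonal subspaces of `ℝ^d`. -/
def JacobiansOrtho {dC dS d : ℕ} (g : E dC × E dS → E d) (c : E dC) (s : E dS) : Prop :=
  Submodule.IsOrtho (contentJacobian g c s).toLinearMap.range
    (styleJacobian g c s).toLinearMap.range

/-- The multi-domain content-style model `x⁽ⁿ⁾ = g (c, s⁽ⁿ⁾)`, with domains indexed by `ι`.
The law of the content is the same in all domains; content and style may be dependent. -/
structure Model (ι : Type*) (dC dS d : ℕ) where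
  /-- the content space -/
  C : Set (E dC)
  /-- the style space of each domain -/
  S : ι → Set (E dS)
  /-- the generator; only its values on `C × ⋃ n, S n` matter -/
  g : E dC × E dS → E d
  /-- the law of the content `c`, common to all domains -/
  pc : Measure (E dC)
  /-- the joint law of `(c, s⁽ⁿ⁾)` -/
  P : ι → Measure (E dC × E dS)
  isOpen_C : IsOpen C
  isSimplyConnected_C : IsSimplyConnected C
  isOpen_S : ∀ n, IsOpen (S n)
  isSimplyConnected_S : ∀ n, IsSimplyConnected (S n)
  isProbabilityMeasure_P : ∀ n, IsProbabilityMeasure (P n)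
  /-- `(c, s⁽ⁿ⁾)` takes its values in `C × S n`. -/
  P_compl : ∀ n, P n (C ×ˢ S n)ᶜ = 0
  /-- The content marginal is `pc` in every domain. -/
  map_fst_P : ∀ n, (P n).map Prod.fst = pc
  /-- Every neighbourhood of every point of `C` is charged by the content. -/
  C_subset_support : C ⊆ pc.support
  /-- Given the content, `s⁽ⁿ⁾` charges every nonempty open part of `S n` (this is the case if
  `(c, s⁽ⁿ⁾)` has a density that is positive on `C × S n`). -/
  P_pos : ∀ (n : ι) (B : Set (E dC)) (W : Set (E dS)), MeasurableSet B → 0 < pc B →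
    IsOpen W → (W ∩ S n).Nonempty → 0 < P n (B ×ˢ W)
  /-- The generator is (first-order) differentiable. -/
  differentiableOn_g : DifferentiableOn ℝ g (C ×ˢ ⋃ n, S n)
  /-- The generator is a bijection onto its image. -/
  injOn_g : InjOn g (C ×ˢ ⋃ n, S n)

namespace Model

variable {ι : Type*} {dC dS d : ℕ}

/-- The union of the style spaces of all domains. -/
def styleSpace (M : Model ι dC dS d) : Set (E dS) := ⋃ n, M.S n

/-- The data space `X = g (C × S)`. -/
def dataSpace (M : Model ι dC dS d) : Set (E d) := M.g '' (M.C ×ˢ M.styleSpace)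

/-- Domain variability: every measurable `A ⊆ C × S` that has positive probability in all domains
and that is not of the form `B × S` (up to sets which are null in all domains) has different
probabilities in some two domains. -/
def DomainVariability (M : Model ι dC dS d) : Prop :=
  ∀ A : Set (E dC × E dS), A ⊆ M.C ×ˢ M.styleSpace → MeasurableSet A → (∀ n, 0 < M.P n A) →
    (¬ ∃ B : Set (E dC), B ⊆ M.C ∧ MeasurableSet B ∧
      ∀ n, A =ᵐ[M.P n] (B ×ˢ M.styleSpace : Set (E dC × E dS))) →
    ∃ i j, M.P i A ≠ M.P j A

/-- Content-style differential independence of the true generator. -/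
def CSDI (M : Model ι dC dS d) : Prop :=
  ∀ n, ∀ c ∈ M.C, ∀ s ∈ M.S n, JacobiansOrtho M.g c s

/-- The style Jacobian of the true generator has full column rank `dS` everywhere. -/
def FullStyleRank (M : Model ι dC dS d) : Prop :=
  ∀ n, ∀ c ∈ M.C, ∀ s ∈ M.S n,
    Module.finrank ℝ (styleJacobian M.g c s).toLinearMap.range = dS

end Model

/-- An invertible solution of the learning problem for the data of `M`: a generator `ĝ` mapping
`Ĉ × Ŝ` bijectively onto the data space, differentiable with differentiable inverse `f̂`, and laws
of `(ĉ, ŝ⁽ⁿ⁾)` with a common law of `ĉ`, such that `ĝ (ĉ, ŝ⁽ⁿ⁾)` and `x⁽ⁿ⁾ = g (c, s⁽ⁿ⁾)` have the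
same distribution for all `n`, and the content and style Jacobians of `ĝ` are orthogonal. -/
structure Solution {ι : Type*} {dC dS d : ℕ} (M : Model ι dC dS d) where
  /-- the learned content space `Ĉ` -/
  C : Set (E dC)
  /-- the learned style space `Ŝ` -/
  S : Set (E dS)
  /-- the learned generator `ĝ` -/
  g : E dC × E dS → E d
  /-- the inverse `f̂` of the learned generator; only its values on the data space matter -/
  f : E d → E dC × E dS
  /-- the law of the learned content `ĉ`, common to all domains -/
  pc : Measure (E dC)
  /-- the joint law of `(ĉ, ŝ⁽ⁿ⁾)` -/
  P : ι → Measure (E dC × E dS)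
  isOpen_C : IsOpen C
  isOpen_S : IsOpen S
  isProbabilityMeasure_P : ∀ n, IsProbabilityMeasure (P n)
  P_compl : ∀ n, P n (C ×ˢ S)ᶜ = 0
  map_fst_P : ∀ n, (P n).map Prod.fst = pc
  differentiableOn_g : DifferentiableOn ℝ g (C ×ˢ S)
  image_g : g '' (C ×ˢ S) = M.dataSpace
  leftInvOn_f : LeftInvOn f g (C ×ˢ S)
  differentiableOn_f : DifferentiableOn ℝ f M.dataSpace
  /-- Distribution matching in every domain. -/
  distribution_matching : ∀ n, (P n).map g = (M.P n).map M.g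
  /-- Orthogonality of the learned content and style Jacobians. -/
  jacobiansOrtho : ∀ c ∈ C, ∀ s ∈ S, JacobiansOrtho g c s

end ContentStyle

/-! Let `φ = f̂ ∘ g` be the transition from true to learned latents, a differentiable bijection `C ×
S → Ĉ × Ŝ`.

Content. For open `O`, the event `φ₁ ∈ O` has the same probability in every domain, because the law
of the learned content is shared. If `φ₁` took different values at `(c, s)` and `(c, s')`, disjoint
neighbourhoods of these values would give such an event containing a box around `(c, s)` and missing
a box around `(c, s')`. It could not be a cylinder `B × S` up to null sets, against domain
variability (`transition_fst_eq`). So `φ₁ = γ(c)`, and `γ` is onto because `φ` is. Injectivity is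
subtler, since `φ` may have singular derivative: invariance of domain makes `φ⁻¹` continuous, which
yields a continuous section of `γ` whose image is open and closed in the connected set `C`
(`injOn_of_bijOn_prod`).

Style. As `φ₁` ignores `s`, `Dφ` is block triangular; full style rank makes its style block `b`
invertible. Orthogonality for `g` and for `ĝ` together force `Dĝ (0, ∂_c φ₂) = 0`, hence `∂_c φ₂ =
0` (`fderiv_transition_snd_eq_zero`), and `φ₂` is constant in `c` on the connected set `C`.

Invariance of domain is derived from the absence of `C¹` retractions of a ball onto its sphere, by
way of a form of Brouwer's theorem. -/

namespace ContentStyle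

/-! ### Jacobian determinants and the no-retraction theorem -/

section Retraction

variable {V : Type*} [NormedAddCommGroup V] [InnerProductSpace ℝ V] [FiniteDimensional ℝ V]

/-- `det (1 + t A)` is a polynomial in `t` of degree at most the dimension. -/
theorem exists_polynomial_eval_eq_det_one_add_smul (A : V →L[ℝ] V) :
    ∃ p : Polynomial ℝ, p.degree < (Module.finrank ℝ V + 1 : ℕ) ∧
      ∀ t : ℝ, p.eval t = (1 + t • A).det := by
  let b := Module.finBasis ℝ V
  let M := LinearMap.toMatrix b b A.toLinearMap
  let I : Matrix (Fin (Module.finrank ℝ V)) (Fin (Module.finrank ℝ V)) ℝ := 1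
  refine ⟨((Polynomial.X : Polynomial ℝ) • M.map Polynomial.C + I.map Polynomial.C).det, ?_, ?_⟩
  · refine lt_of_le_of_lt Polynomial.degree_le_natDegree ?_
    have h := Polynomial.natDegree_det_X_add_C_le M I
    rw [Fintype.card_fin] at h
    exact_mod_cast Nat.lt_succ_of_le h
  · intro t
    have h1 : (1 + t • A).det = (LinearMap.toMatrix b b (1 + t • A).toLinearMap).det :=
      (LinearMap.det_toMatrix b _).symm
    have h2 : LinearMap.toMatrix b b (1 + t • A).toLinearMap = 1 + t • M := by
      have h3 : (1 + t • A).toLinearMap = LinearMap.id + t • A.toLinearMap := rfl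
      rw [h3, map_add, map_smul, LinearMap.toMatrix_id]
    rw [h1, h2, ← Polynomial.coe_evalRingHom, RingHom.map_det]
    congr 1
    ext i j
    by_cases hij : i = j <;> simp [I, hij, add_comm] <;> exact mul_comm _ _

/-- Lagrange interpolation expresses the value at `t = 1` linearly through arbitrarily small `t`, so
integral identities for small perturbations extend to large ones. -/
theorem det_one_add_eq_sum_basis_mul (A : V →L[ℝ] V) {v : Fin (Module.finrank ℝ V + 1) → ℝ}
    (hv : Function.Injective v) :
    (1 + A).det = ∑ i, (Lagrange.basis Finset.univ v i).eval 1 * (1 + v i • A).det := by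
  obtain ⟨p, hp, h⟩ := exists_polynomial_eval_eq_det_one_add_smul A
  have h1 := congrArg (Polynomial.eval 1)
    (Lagrange.eq_interpolate (s := Finset.univ) (f := p) hv.injOn (by simpa using hp))
  rw [h, Lagrange.interpolate_apply, Polynomial.eval_finsetSum] at h1
  simpa [h, mul_comm] using h1

/-- A perturbation of the identity of operator norm less than one has positive determinant. -/
theorem det_one_add_pos {A : V →L[ℝ] V} (hA : ‖A‖ < 1) : 0 < (1 + A).det := by
  have hne : ∀ t ∈ Icc (0 : ℝ) 1, (1 + t • A).det ≠ 0 := by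
    intro t ht h0
    obtain ⟨x, hx, hx0⟩ := Submodule.exists_mem_ne_zero_of_ne_bot
      (LinearMap.bot_lt_ker_of_det_eq_zero h0).ne'
    have h1 : x = - (t • A x) := by
      rw [eq_neg_iff_add_eq_zero]
      simpa using hx
    have h2 : ‖x‖ ≤ ‖A‖ * ‖x‖ := by
      calc ‖x‖ = ‖t • A x‖ := by conv_lhs => rw [h1, norm_neg]
        _ ≤ 1 * ‖A x‖ := by
          rw [norm_smul, Real.norm_of_nonneg ht.1]
          gcongr
          exact ht.2
        _ ≤ ‖A‖ * ‖x‖ := by simpa using A.le_opNorm x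
    have h3 : 0 < ‖x‖ := norm_pos_iff.2 hx0
    nlinarith
  by_contra hneg
  have hc : ContinuousOn (fun t : ℝ => (1 + t • A).det) (Icc 0 1) := by
    obtain ⟨p, -, h⟩ := exists_polynomial_eval_eq_det_one_add_smul A
    simp_rw [← h]
    exact p.continuous.continuousOn
  have h0 : (0 : ℝ) ∈ Icc ((1 + (1 : ℝ) • A).det) ((1 + (0 : ℝ) • A).det) := by
    simp only [one_smul, zero_smul, add_zero]
    exact ⟨not_lt.1 hneg, by simp [ContinuousLinearMap.det]⟩
  obtain ⟨t, ht, h⟩ := intermediate_value_Icc' zero_le_one hc h0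
  exact hne t ht h

/-- A preimage of `y` is a fixed point of the contraction `x ↦ y - g x`. -/
theorem bijective_id_add_of_lipschitzWith {g : V → V} {K : NNReal} (hg : LipschitzWith K g)
    (hK : K < 1) : Function.Bijective fun x => x + g x := by
  constructor
  · intro x y hxy
    have h1 : x - y = - (g x - g y) := by
      simp only at hxy
      rw [neg_sub, sub_eq_sub_iff_add_eq_add, hxy, add_comm]
    have h2 : ‖x - y‖ ≤ K * ‖x - y‖ := by
      conv_lhs => rw [h1, norm_neg]
      exact hg.norm_sub_le x y
    have hK' : (K : ℝ) < 1 := hK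
    have h3 : ‖x - y‖ = 0 := by nlinarith [norm_nonneg (x - y)]
    exact sub_eq_zero.1 (norm_eq_zero.1 h3)
  · intro y
    have hc : ContractingWith K fun x => y - g x := by
      refine ⟨hK, LipschitzWith.of_dist_le_mul fun a b => ?_⟩
      rw [dist_sub_left]
      exact hg.dist_le_mul a b
    refine ⟨hc.fixedPoint, ?_⟩
    have := hc.fixedPoint_isFixedPt
    have h : y - g hc.fixedPoint = hc.fixedPoint := this
    simp only
    nth_rewrite 1 [← h]
    abel

variable [MeasurableSpace V] [BorelSpace V]

/-- A small Lipschitz perturbation of the identity that is supported in `s` preserves the volume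
of `s`, computed by integrating the determinant. -/
theorem integral_det_one_add_fderiv {g : V → V} {K : NNReal} (hg : LipschitzWith K g)
    (hK : K < 1) {s : Set V} (hs : IsOpen s) (hgs : ∀ x ∉ s, g x = 0)
    (hd : DifferentiableOn ℝ g s) (hfin : volume s ≠ ⊤) :
    IntegrableOn (fun x => (1 + fderiv ℝ g x).det) s ∧
      ∫ x in s, (1 + fderiv ℝ g x).det = volume.real s := by
  have hbij := bijective_id_add_of_lipschitzWith hg hK
  have himg : (fun x => x + g x) '' s = s := by
    apply Subset.antisymm
    · rintro _ ⟨x, hx, rfl⟩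
      by_contra h
      have h1 : x + g x = x := hbij.1 (by simp [hgs _ h])
      exact h (by simpa only [h1] using hx)
    · intro y hy
      obtain ⟨x, rfl⟩ := hbij.2 y
      refine ⟨x, ?_, rfl⟩
      by_contra h
      exact h (by simpa [hgs x h] using hy)
  have hder : ∀ x ∈ s, HasFDerivWithinAt (fun x => x + g x) (1 + fderiv ℝ g x) s x := by
    intro x hx
    exact (hasFDerivWithinAt_id x s).add
      ((hd x hx).differentiableAt (hs.mem_nhds hx)).hasFDerivAt.hasFDerivWithinAt
  have habs : ∀ x ∈ s, |(1 + fderiv ℝ g x).det| = (1 + fderiv ℝ g x).det := fun x hx =>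
    abs_of_pos (det_one_add_pos ((norm_fderiv_le_of_lipschitz ℝ hg).trans_lt hK))
  have hint := (integrableOn_image_iff_integrableOn_abs_det_fderiv_smul volume hs.measurableSet
    hder hbij.1.injOn (fun _ => (1 : ℝ)))
  have hval := (integral_image_eq_integral_abs_det_fderiv_smul volume hs.measurableSet
    hder hbij.1.injOn (fun _ => (1 : ℝ)))
  rw [himg] at hint hval
  simp only [smul_eq_mul, mul_one] at hint hval
  constructor
  · refine (hint.1 (integrableOn_const hfin)).congr_fun habs hs.measurableSet
  · rw [← setIntegral_congr_fun hs.measurableSet habs, ← hval]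
    simp

/-- The integral of the Jacobian determinant of a Lipschitz map that is the identity off `s` is the
volume of `s`. -/
theorem integral_det_one_add_fderiv_of_lipschitzWith {g : V → V} {K : NNReal}
    (hg : LipschitzWith K g) {s : Set V} (hs : IsOpen s) (hgs : ∀ x ∉ s, g x = 0)
    (hd : DifferentiableOn ℝ g s) (hfin : volume s ≠ ⊤) :
    ∫ x in s, (1 + fderiv ℝ g x).det = volume.real s := by
  -- Distinct nodes with `v i * K < 1`, so that each `v i • g` is a contraction.
  let v : Fin (Module.finrank ℝ V + 1) → ℝ := fun i => ((K : ℝ) + 1)⁻¹ * ((i : ℕ) + 1 : ℝ)⁻¹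
  have hK : (0 : ℝ) < K + 1 := by positivity
  have hv : Function.Injective v := by
    intro i j hij
    have h1 := mul_left_cancel₀ (inv_ne_zero hK.ne') hij
    have h2 := inv_injective h1
    exact Fin.ext (by exact_mod_cast add_right_cancel h2)
  have hvi : ∀ i, IntegrableOn (fun x => (1 + v i • fderiv ℝ g x).det) s ∧
      ∫ x in s, (1 + v i • fderiv ℝ g x).det = volume.real s := by
    intro i
    have hvp : 0 < v i := by positivity
    have hlip : LipschitzWith (‖v i‖₊ * K) (fun x => v i • g x) :=
      (lipschitzWith_smul (v i)).comp hg
    have hlt : ‖v i‖₊ * K < 1 := by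
      rw [← NNReal.coe_lt_coe]
      push_cast
      rw [Real.norm_of_nonneg hvp.le]
      have h1 : ((i : ℕ) + 1 : ℝ)⁻¹ ≤ 1 := inv_le_one_of_one_le₀ (by simp)
      calc v i * K ≤ (K + 1 : ℝ)⁻¹ * 1 * K := by
            simp only [v]; gcongr
        _ < 1 := by
            rw [mul_one, inv_mul_lt_iff₀ hK]; linarith
    have := integral_det_one_add_fderiv hlip hlt hs (fun x hx => by simp [hgs x hx])
      (hd.const_smul (v i)) hfin
    have hfd : ∀ x ∈ s, (1 + fderiv ℝ (fun x => v i • g x) x).det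
        = (1 + v i • fderiv ℝ g x).det := by
      intro x hx
      rw [fderiv_fun_const_smul ((hd x hx).differentiableAt (hs.mem_nhds hx))]
    rw [integrableOn_congr_fun hfd hs.measurableSet,
      setIntegral_congr_fun hs.measurableSet hfd] at this
    exact this
  rw [setIntegral_congr_fun hs.measurableSet fun x _ => det_one_add_eq_sum_basis_mul _ hv]
  rw [integral_finsetSum _ fun i _ => (hvi i).1.const_mul _]
  simp_rw [integral_const_mul, (hvi _).2]
  -- The Lagrange basis sums to one, so interpolating a constant returns it.
  rw [← Finset.sum_mul, ← Polynomial.eval_finsetSum,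
    Lagrange.sum_basis hv.injOn Finset.univ_nonempty]
  simp

/-- There is no `C¹` retraction of a closed ball onto its boundary sphere. -/
theorem not_contDiff_retraction {R : ℝ} (hR : 0 < R) {r : V → V} (hr : ContDiff ℝ 1 r)
    (hn : ∀ x, ‖r x‖ = R) (hs : ∀ x, ‖x‖ = R → r x = x) : False := by
  obtain ⟨K, hK⟩ := ((hr.sub contDiff_id).locallyLipschitz.locallyLipschitzOn
    (s := Metric.closedBall (0 : V) R)).exists_lipschitzOnWith_of_compact
    (isCompact_closedBall 0 R)
  let g : V → V := (Metric.ball (0 : V) R).indicator fun x => r x - x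
  have hgin : ∀ x ∈ Metric.closedBall (0 : V) R, g x = r x - x := by
    intro x hx
    by_cases h : x ∈ Metric.ball (0 : V) R
    · exact indicator_of_mem h _
    · have hx' : ‖x‖ = R := le_antisymm (by simpa using hx) (by simpa using h)
      simp [g, hs x hx']
  have hgout : ∀ x ∉ Metric.ball (0 : V) R, g x = 0 := fun x hx => indicator_of_notMem hx _
  -- The segment from `x` to `y` meets the sphere at a point `z` where `g` vanishes; the bound
  -- inside the ball applies to `x` and `z`.
  have hcross : ∀ x ∈ Metric.closedBall (0 : V) R, ∀ y ∉ Metric.closedBall (0 : V) R,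
      dist (g x) (g y) ≤ K * dist x y := by
    intro x hx y hy
    have hc : ContinuousOn (fun t : ℝ => ‖AffineMap.lineMap x y t‖) (Icc 0 1) := by
      apply Continuous.continuousOn
      exact (AffineMap.lineMap_continuous).norm
    obtain ⟨t, ht, htR⟩ := intermediate_value_Icc zero_le_one hc
      (show R ∈ Icc _ _ by
        simp only [AffineMap.lineMap_apply_zero, AffineMap.lineMap_apply_one]
        simp only [mem_closedBall_zero_iff, not_le] at hx hy
        exact ⟨hx, hy.le⟩)
    simp only at htR
    set z : V := AffineMap.lineMap x y t
    have hz : z ∈ Metric.closedBall (0 : V) R := by simp [htR]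
    have hgz : g z = 0 := by rw [hgin z hz, hs z htR, sub_self]
    have hgy : g y = 0 := hgout y fun h => hy (Metric.ball_subset_closedBall h)
    rw [hgy, ← hgz, hgin x hx, hgin z hz]
    refine (hK.dist_le_mul x hx z hz).trans ?_
    gcongr
    rw [dist_left_lineMap, Real.norm_of_nonneg ht.1]
    exact mul_le_of_le_one_left dist_nonneg ht.2
  have hlip : LipschitzWith K g := by
    refine LipschitzWith.of_dist_le_mul fun x y => ?_
    by_cases hx : x ∈ Metric.closedBall (0 : V) R <;>
      by_cases hy : y ∈ Metric.closedBall (0 : V) R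
    · rw [hgin x hx, hgin y hy]
      exact hK.dist_le_mul x hx y hy
    · exact hcross x hx y hy
    · rw [dist_comm, dist_comm x]
      exact hcross y hy x hx
    · rw [hgout x fun h => hx (Metric.ball_subset_closedBall h),
        hgout y fun h => hy (Metric.ball_subset_closedBall h), dist_self]
      positivity
  have hrd : ∀ x, HasFDerivAt r (fderiv ℝ r x) x := fun x =>
    ((hr.differentiable one_ne_zero) x).hasFDerivAt
  have hder : ∀ x ∈ Metric.ball (0 : V) R, HasFDerivAt g (fderiv ℝ r x - 1) x := by
    intro x hx
    refine ((hrd x).sub (hasFDerivAt_id x)).congr_of_eventuallyEq ?_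
    filter_upwards [Metric.isOpen_ball.mem_nhds hx] with y hy
    exact hgin y (Metric.ball_subset_closedBall hy)
  -- Since `‖r‖²` is constant, the range of `Dr` is orthogonal to `r x ≠ 0`, so `Dr` is singular.
  have hdet : ∀ x ∈ Metric.ball (0 : V) R, (1 + fderiv ℝ g x).det = 0 := by
    intro x hx
    rw [(hder x hx).fderiv, add_sub_cancel]
    by_contra hne
    have hsurj : Function.Surjective (fderiv ℝ r x) := by
      have h := LinearMap.surjective_of_injective (LinearMap.ker_eq_bot.1 (by
        by_contra hker
        exact hne (LinearMap.det_eq_zero_iff_ker_ne_bot.2 hker)) :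
          Function.Injective (fderiv ℝ r x).toLinearMap)
      exact h
    have h1 := (hrd x).norm_sq
    have h2 : HasFDerivAt (fun x => ‖r x‖ ^ 2) (0 : V →L[ℝ] ℝ) x := by
      simp_rw [hn]
      exact hasFDerivAt_const _ _
    obtain ⟨v, hv⟩ := hsurj (r x)
    have h3 := congrArg (fun A : V →L[ℝ] ℝ => A v) (h1.unique h2)
    have h4 : ‖r x‖ = 0 := by simpa [hv] using h3
    exact hR.ne' ((hn x).symm.trans h4)
  have hvol := integral_det_one_add_fderiv_of_lipschitzWith hlip Metric.isOpen_ball hgout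
    (fun x hx => (hder x hx).differentiableAt.differentiableWithinAt)
    (Metric.isBounded_ball.measure_lt_top (μ := volume)).ne
  rw [setIntegral_congr_fun measurableSet_ball hdet] at hvol
  have hpos : 0 < volume.real (Metric.ball (0 : V) R) :=
    ENNReal.toReal_pos (Metric.measure_ball_pos volume _ hR).ne'
      (Metric.isBounded_ball.measure_lt_top).ne
  simp at hvol
  linarith

/-! ### Brouwer's theorem and invariance of domain -/

/-- A continuous map on the closed unit ball at distance at most one from the identity
has a zero; this is a form of Brouwer's fixed point theorem. -/
theorem exists_eq_zero_of_norm_sub_le {H : V → V} (hH : ContinuousOn H (Metric.closedBall 0 1))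
    (hle : ∀ x ∈ Metric.closedBall (0 : V) 1, ‖H x - x‖ ≤ 1) :
    ∃ x ∈ Metric.closedBall (0 : V) 1, H x = 0 := by
  by_contra! hne
  let p : V → V := fun x => (max 1 ‖x‖)⁻¹ • x
  have hpos : ∀ x : V, 0 < max 1 ‖x‖ := fun x => lt_max_of_lt_left one_pos
  have hpc : Continuous p := by
    refine Continuous.smul (Continuous.inv₀ (by fun_prop) fun x => (hpos x).ne') continuous_id
  have hpB : ∀ x, p x ∈ Metric.closedBall (0 : V) 1 := by
    intro x
    rw [mem_closedBall_zero_iff, norm_smul, Real.norm_of_nonneg (inv_nonneg.2 (hpos x).le),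
      inv_mul_le_iff₀ (hpos x), mul_one]
    exact le_max_right _ _
  have hpid : ∀ x ∈ Metric.closedBall (0 : V) 1, p x = x := by
    intro x hx
    simp [p, max_eq_left (mem_closedBall_zero_iff.1 hx)]
  -- The displacement of `H`, extended to all of `V` by the radial retraction `p`; `x + k x` still
  -- has no zero.
  let k : V → V := fun x => H (p x) - p x
  have hkc : Continuous k := (hH.comp_continuous hpc hpB).sub hpc
  have hk1 : ∀ x, ‖k x‖ ≤ 1 := fun x => hle _ (hpB x)
  have hk0 : ∀ x, x + k x ≠ 0 := by
    intro x hx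
    by_cases h : x ∈ Metric.closedBall (0 : V) 1
    · apply hne x h
      simpa [k, hpid x h] using hx
    · rw [mem_closedBall_zero_iff, not_le] at h
      have h1 : ‖x‖ = ‖k x‖ := by
        conv_lhs => rw [eq_neg_of_add_eq_zero_left hx, norm_neg]
      linarith [hk1 x]
  obtain ⟨q, hq, hqk, -⟩ := hkc.exists_contDiff_approx 1 (ε := fun x => min 1 ‖x + k x‖)
    (by fun_prop) fun x => lt_min one_pos (norm_pos_iff.2 (hk0 x))
  -- Here `‖q‖ < 2`, so `x + χ x • q x` cannot vanish for `‖x‖ > 3`, and it equals `x` on the sphere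
  -- of radius 4. Normalising it gives a forbidden retraction.
  let χ : ContDiffBump (0 : V) := ⟨3, 4, by norm_num, by norm_num⟩
  let h : V → V := fun x => x + χ x • q x
  have hh : ContDiff ℝ 1 h := contDiff_id.add (χ.contDiff.smul (by exact_mod_cast hq))
  have hh0 : ∀ x, h x ≠ 0 := by
    intro x hx
    have hlt := lt_min_iff.1 (hqk x)
    rw [dist_eq_norm] at hlt
    by_cases hx3 : ‖x‖ ≤ 3
    · have h1 : χ x = 1 := χ.one_of_mem_closedBall (by simpa using hx3)
      have h2 : x + q x = 0 := by simpa [h, h1] using hx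
      have h3 : x + k x = -(q x - k x) := by
        calc x + k x = (x + q x) - (q x - k x) := by abel
          _ = -(q x - k x) := by rw [h2, zero_sub]
      have h4 := hlt.2
      rw [h3, norm_neg] at h4
      exact lt_irrefl _ h4
    · have h1 : ‖x‖ = ‖χ x • q x‖ := by
        conv_lhs => rw [eq_neg_of_add_eq_zero_left hx, norm_neg]
      have h2 : ‖χ x • q x‖ ≤ ‖q x‖ := by
        rw [norm_smul, Real.norm_of_nonneg χ.nonneg]
        exact mul_le_of_le_one_left (norm_nonneg _) χ.le_one
      have h3 : ‖q x‖ ≤ ‖q x - k x‖ + ‖k x‖ := by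
        simpa using norm_add_le (q x - k x) (k x)
      linarith [hk1 x, hlt.1]
  refine not_contDiff_retraction (R := 4) (r := fun x => (4 * ‖h x‖⁻¹) • h x) (by norm_num) ?_ ?_ ?_
  · exact (contDiff_const.mul ((hh.norm ℝ hh0).inv fun x => norm_ne_zero_iff.2 (hh0 x))).smul hh
  · intro x
    have := norm_ne_zero_iff.2 (hh0 x)
    rw [norm_smul, norm_mul, norm_inv, norm_norm, mul_assoc, inv_mul_cancel₀ this]
    norm_num
  · intro x hx
    have h1 : χ x = 0 := χ.zero_of_le_dist (by simp [hx, χ])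
    have h2 : h x = x := by simp [h, h1]
    simp only [h2, hx]
    norm_num

/-- The image of the closed unit ball under a continuous injective map is a neighbourhood of the
image of the centre. -/
theorem image_closedBall_mem_nhds {f : V → V} (hf : ContinuousOn f (Metric.closedBall 0 1))
    (hinj : InjOn f (Metric.closedBall 0 1)) : f '' Metric.closedBall 0 1 ∈ nhds (f 0) := by
  by_contra hnot
  set B : Set V := Metric.closedBall 0 1
  have hB : IsCompact B := isCompact_closedBall 0 1
  have hB0 : (0 : V) ∈ B := by simp [B]
  have hYc : IsCompact (f '' B) := hB.image_of_continuousOn hf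
  -- Tietze extension of the inverse of `f` on its compact image.
  obtain ⟨G, hG⟩ : ∃ G : C(V, V), ∀ x ∈ B, G (f x) = x := by
    have : CompactSpace B := isCompact_iff_compactSpace.1 hB
    have he : Topology.IsClosedEmbedding (B.domRestrict f) :=
      (continuousOn_iff_continuous_domRestrict.1 hf).isClosedEmbedding
        (injOn_iff_injective.1 hinj)
    obtain ⟨G, hG⟩ := ContinuousMap.exists_extension' he ⟨Subtype.val, continuous_subtype_val⟩
    exact ⟨G, fun x hx => congrFun hG ⟨x, hx⟩⟩
  have hG0 : G (f 0) = 0 := hG 0 hB0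
  obtain ⟨η, hη, hηG⟩ := Metric.continuousAt_iff.1 G.continuous.continuousAt (1 / 10)
    (by norm_num : (0 : ℝ) < 1 / 10)
  rw [hG0] at hηG
  -- The `ε`-ball around a point `c` within `ε` of `f 0` stays within `3 * ε` of `f 0`, where `G` is
  -- small.
  obtain ⟨ε, hε, rfl⟩ : ∃ ε, 0 < ε ∧ η = 3 * ε := ⟨η / 3, by positivity, by ring⟩
  obtain ⟨c, hcε, hcY⟩ : ∃ c, dist c (f 0) < ε ∧ c ∉ f '' B := by
    by_contra! h
    exact hnot (Filter.mem_of_superset (Metric.ball_mem_nhds (f 0) hε) fun y hy => h y hy)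
  have hne : ∀ y ∈ f '' B, y - c ≠ 0 := fun y hy h => hcY (sub_eq_zero.1 h ▸ hy)
  have hfar : IsCompact (f '' B ∩ {y | ε ≤ ‖y - c‖}) :=
    hYc.inter_right (isClosed_le continuous_const (by fun_prop))
  have hGne : ∀ y ∈ f '' B ∩ {y | ε ≤ ‖y - c‖}, G y ≠ 0 := by
    rintro _ ⟨⟨x, hx, rfl⟩, hxε⟩ h
    rw [hG x hx] at h
    subst h
    rw [dist_comm, dist_eq_norm] at hcε
    exact absurd hxε (not_le.2 hcε)
  obtain ⟨δ, hδ, hδ1, hδG⟩ : ∃ δ, 0 < δ ∧ δ ≤ 1 / 10 ∧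
      ∀ y ∈ f '' B ∩ {y | ε ≤ ‖y - c‖}, δ ≤ ‖G y‖ := by
    obtain ⟨b, hb⟩ := hfar.exists_bound_of_continuousOn (f := fun y => ‖G y‖⁻¹)
      (ContinuousOn.inv₀ (by fun_prop) fun y hy => norm_ne_zero_iff.2 (hGne y hy))
    refine ⟨(max b 10)⁻¹, by positivity, ?_, fun y hy => ?_⟩
    · rw [one_div]
      exact inv_anti₀ (by norm_num) (le_max_right _ _)
    · have h1 := (hb y hy).trans (le_max_left b 10)
      rw [Real.norm_of_nonneg (by positivity)] at h1
      exact inv_le_of_inv_le₀ (norm_pos_iff.2 (hGne y hy)) h1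
  obtain ⟨P, hP, hPG, -⟩ := G.continuous.exists_contDiff_approx 1 (ε := fun _ => δ / 2)
    continuous_const fun _ => by positivity
  -- A `C¹` map sends the null sphere to a null set, so some small shift `w` makes `P - w` zero-free
  -- there.
  have hnull : volume (P '' Metric.sphere c ε) = 0 :=
    addHaar_image_eq_zero_of_differentiableOn_of_addHaar_eq_zero volume
      (hP.differentiable (by simp)).differentiableOn
      (Measure.addHaar_sphere_of_ne_zero volume c hε.ne')
  obtain ⟨w, hw, hwP⟩ : ∃ w ∈ Metric.ball (0 : V) (δ / 2), w ∉ P '' Metric.sphere c ε := by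
    by_contra! h
    exact (Metric.measure_ball_pos volume (0 : V) (half_pos hδ)).ne' (measure_mono_null h hnull)
  have hQG : ∀ y, ‖P y - w - G y‖ < δ := by
    intro y
    have h1 := hPG y
    rw [dist_eq_norm] at h1
    rw [mem_ball_zero_iff] at hw
    calc ‖P y - w - G y‖ = ‖(P y - G y) - w‖ := by congr 1; abel
      _ ≤ ‖P y - G y‖ + ‖w‖ := norm_sub_le _ _
      _ < δ := by linarith
  -- Pushes the part of the image near `c` radially onto the sphere, which is possible because `c`
  -- is missed.
  let Φ : V → V := fun y => c + (max (ε / ‖y - c‖) 1) • (y - c)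
  have hΦc : ContinuousOn Φ (f '' B) := by
    refine continuousOn_const.add (ContinuousOn.smul (ContinuousOn.sup
      (ContinuousOn.div continuousOn_const (by fun_prop) fun y hy => norm_ne_zero_iff.2 (hne y hy))
      continuousOn_const) (by fun_prop))
  have hΦfar : ∀ y ∈ f '' B, ε ≤ ‖y - c‖ → Φ y = y := by
    intro y hy h
    have : ε / ‖y - c‖ ≤ 1 := (div_le_one (norm_pos_iff.2 (hne y hy))).2 h
    simp [Φ, max_eq_right this]
  have hΦnear : ∀ y ∈ f '' B, ‖y - c‖ < ε → Φ y ∈ Metric.sphere c ε := by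
    intro y hy h
    have hp := norm_pos_iff.2 (hne y hy)
    have : 1 ≤ ε / ‖y - c‖ := (one_le_div hp).2 h.le
    simp only [Φ, max_eq_left this, mem_sphere_iff_norm, add_sub_cancel_left, norm_smul, norm_div,
      norm_norm, Real.norm_of_nonneg hε.le]
    field_simp
  have hnearG : ∀ y, ‖y - c‖ ≤ ε → ‖G y‖ < 1 / 10 := by
    intro y hy
    rw [← dist_eq_norm] at hy
    simpa using hηG (x := y) (by linarith [dist_triangle y c (f 0)])
  -- `P ∘ Φ ∘ f - w` is close to the identity, hence has a zero; but `P - w` vanishes neither on the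
  -- sphere nor on the far part of the image.
  obtain ⟨x, hx, hx0⟩ := exists_eq_zero_of_norm_sub_le (H := fun x => P (Φ (f x)) - w)
    ((hP.continuous.comp_continuousOn (hΦc.comp hf (mapsTo_image f B))).sub continuousOn_const)
    (by
      intro x hx
      have hy : f x ∈ f '' B := mem_image_of_mem f hx
      have h0 := hQG (Φ (f x))
      rcases le_or_gt ε ‖f x - c‖ with h | h
      · rw [hΦfar _ hy h] at h0 ⊢
        rw [hG x hx] at h0
        linarith
      · have h1 := hnearG _ h.le
        have h2 := hnearG _ (mem_sphere_iff_norm.1 (hΦnear _ hy h)).le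
        rw [hG x hx] at h1
        calc ‖P (Φ (f x)) - w - x‖ = ‖(P (Φ (f x)) - w - G (Φ (f x))) + G (Φ (f x)) - x‖ := by
              congr 1; abel
          _ ≤ ‖P (Φ (f x)) - w - G (Φ (f x))‖ + ‖G (Φ (f x))‖ + ‖x‖ :=
              (norm_sub_le _ _).trans (by gcongr; exact norm_add_le _ _)
          _ ≤ 1 := by linarith)
  have hy : f x ∈ f '' B := mem_image_of_mem f hx
  rcases le_or_gt ε ‖f x - c‖ with h | h
  · have h0 := hQG (Φ (f x))
    rw [hx0, hΦfar _ hy h, zero_sub, norm_neg] at h0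
    exact absurd (hδG _ ⟨hy, h⟩) (not_le.2 h0)
  · exact hwP ⟨_, hΦnear _ hy h, sub_eq_zero.1 hx0⟩

theorem isOpen_image_of_injOn_of_inner {f : V → V} {U : Set V} (hU : IsOpen U)
    (hf : ContinuousOn f U) (hinj : InjOn f U) : IsOpen (f '' U) := by
  rw [isOpen_iff_mem_nhds]
  rintro _ ⟨x, hx, rfl⟩
  obtain ⟨r, hr, hrU⟩ := Metric.nhds_basis_closedBall.mem_iff.1 (hU.mem_nhds hx)
  have hmaps : MapsTo (fun z : V => x + r • z) (Metric.closedBall 0 1) U := by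
    intro z hz
    apply hrU
    rw [mem_closedBall_zero_iff] at hz
    rw [mem_closedBall_iff_norm, add_sub_cancel_left, norm_smul, Real.norm_of_nonneg hr.le]
    exact mul_le_of_le_one_right hr.le hz
  have h := image_closedBall_mem_nhds (f := fun z => f (x + r • z))
    (hf.comp (by fun_prop) hmaps)
    (fun a ha b hb hab => by
      have := hinj (hmaps ha) (hmaps hb) hab
      exact smul_right_injective V hr.ne' (add_left_cancel this))
  simp only [smul_zero, add_zero] at h
  refine Filter.mem_of_superset h ?_
  rintro _ ⟨z, hz, rfl⟩
  exact mem_image_of_mem f (hmaps hz)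

end Retraction

/-- **Invariance of domain**: a continuous injective map between open subsets of a finite
dimensional real normed space is open. -/
theorem isOpen_image_of_injOn {N : Type*} [NormedAddCommGroup N] [NormedSpace ℝ N]
    [FiniteDimensional ℝ N] {f : N → N} {U : Set N} (hU : IsOpen U) (hf : ContinuousOn f U)
    (hinj : InjOn f U) : IsOpen (f '' U) := by
  let e := toEuclidean (E := N)
  have h := isOpen_image_of_injOn_of_inner (f := fun x => e (f (e.symm x)))
    (hU.preimage e.symm.continuous)
    (e.continuous.comp_continuousOn (hf.comp e.symm.continuous.continuousOn (mapsTo_preimage _ _)))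
    (fun a ha b hb hab => e.symm.injective (hinj ha hb (e.injective hab)))
  convert h.preimage e.continuous using 1
  ext y
  constructor
  · rintro ⟨x, hx, rfl⟩
    exact ⟨e x, by simpa using hx, by simp⟩
  · rintro ⟨x, hx, hxy⟩
    exact ⟨e.symm x, hx, e.injective hxy⟩

/-! ### Bijections between products -/

/-- If a continuous bijection between products of open sets has a first component that only depends
on the first variable, and the first factor is connected, then that component is injective. -/
theorem injOn_of_bijOn_prod {N N' : Type*} [NormedAddCommGroup N] [NormedSpace ℝ N]
    [FiniteDimensional ℝ N] [NormedAddCommGroup N'] [NormedSpace ℝ N'] [FiniteDimensional ℝ N']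
    {C Ĉ : Set N} {S Ŝ : Set N'} (hC : IsOpen C) (hCc : IsPreconnected C) (hS : IsOpen S)
    (hSn : S.Nonempty) (hĈ : IsOpen Ĉ) {φ : N × N' → N × N'}
    (hφ : ContinuousOn φ (C ×ˢ S)) (hbij : BijOn φ (C ×ˢ S) (Ĉ ×ˢ Ŝ)) {γ : N → N}
    (hγ : ∀ c ∈ C, ∀ s ∈ S, (φ (c, s)).1 = γ c) : InjOn γ C := by
  rcases C.eq_empty_or_nonempty with rfl | ⟨c₀, hc₀⟩
  · exact injOn_empty γ
  obtain ⟨s₀, hs₀⟩ := hSn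
  obtain ⟨ψ, hinv, hψmaps⟩ : ∃ ψ, InvOn ψ φ (C ×ˢ S) (Ĉ ×ˢ Ŝ) ∧ MapsTo ψ (Ĉ ×ˢ Ŝ) (C ×ˢ S) :=
    ⟨_, hbij.invOn_invFunOn, hbij.surjOn.mapsTo_invFunOn⟩
  -- By invariance of domain `φ` is open, so its inverse is continuous.
  have hψ : ContinuousOn ψ (Ĉ ×ˢ Ŝ) := by
    rw [continuousOn_iff']
    intro t ht
    refine ⟨φ '' ((C ×ˢ S) ∩ t), isOpen_image_of_injOn ((hC.prod hS).inter ht)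
      (hφ.mono inter_subset_left) (hbij.injOn.mono inter_subset_left), ?_⟩
    ext q
    constructor
    · rintro ⟨hq, hq'⟩
      exact ⟨⟨ψ q, ⟨hψmaps hq', hq⟩, hinv.2 hq'⟩, hq'⟩
    · rintro ⟨⟨p, ⟨hp, hpt⟩, rfl⟩, hq'⟩
      exact ⟨by rw [mem_preimage, hinv.1 hp]; exact hpt, hq'⟩
  -- This slice makes `σ` below a section of `γ` whose image contains `c₀`.
  set t₀ := (φ (c₀, s₀)).2
  have h₀ : φ (c₀, s₀) ∈ Ĉ ×ˢ Ŝ := hbij.mapsTo ⟨hc₀, hs₀⟩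
  have ht₀ : t₀ ∈ Ŝ := h₀.2
  let σ : N → N := fun a => (ψ (a, t₀)).1
  have hσmaps : MapsTo σ Ĉ C := fun a ha => (hψmaps (show (a, t₀) ∈ Ĉ ×ˢ Ŝ from ⟨ha, ht₀⟩)).1
  have hγmaps : MapsTo γ C Ĉ := by
    intro c hc
    have : φ (c, s₀) ∈ Ĉ ×ˢ Ŝ := hbij.mapsTo ⟨hc, hs₀⟩
    rw [← hγ c hc s₀ hs₀]
    exact this.1
  have hσc : ContinuousOn σ Ĉ :=
    continuous_fst.comp_continuousOn (hψ.comp (by fun_prop) fun a ha => ⟨ha, ht₀⟩)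
  have hγc : ContinuousOn γ C := by
    have : ContinuousOn (fun c => (φ (c, s₀)).1) C :=
      continuous_fst.comp_continuousOn (hφ.comp (by fun_prop) fun c hc => ⟨hc, hs₀⟩)
    exact this.congr fun c hc => (hγ c hc s₀ hs₀).symm
  have hγσ : ∀ a ∈ Ĉ, γ (σ a) = a := by
    intro a ha
    have h1 : (a, t₀) ∈ Ĉ ×ˢ Ŝ := ⟨ha, ht₀⟩
    have h2 := hψmaps h1
    rw [← hγ (σ a) h2.1 (ψ (a, t₀)).2 h2.2]
    exact congrArg Prod.fst (hinv.2 h1)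
  have hσinj : InjOn σ Ĉ := fun a ha b hb hab => by rw [← hγσ a ha, ← hγσ b hb, hab]
  have hopen : IsOpen (σ '' Ĉ) := isOpen_image_of_injOn hĈ hσc hσinj
  have hσγ : ContinuousOn (fun c => σ (γ c) - c) C :=
    (hσc.comp hγc hγmaps).sub continuousOn_id
  have hopen' : IsOpen (C ∩ (fun c => σ (γ c) - c) ⁻¹' {0}ᶜ) :=
    hσγ.isOpen_inter_preimage hC isOpen_compl_singleton
  have hfix : ∀ c ∈ σ '' Ĉ, σ (γ c) = c := by
    rintro _ ⟨a, ha, rfl⟩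
    rw [hγσ a ha]
  -- The image of `σ` and the set where `σ ∘ γ` moves points are open, disjoint and cover `C`.
  have hsub : C ⊆ σ '' Ĉ := by
    refine hCc.subset_left_of_subset_union hopen hopen' ?_ ?_ ⟨c₀, hc₀, γ c₀, hγmaps hc₀, ?_⟩
    · rw [Set.disjoint_left]
      rintro c hc ⟨-, hc'⟩
      exact hc' (by simp [hfix c hc])
    · intro c hc
      by_cases h : σ (γ c) = c
      · exact Or.inl ⟨γ c, hγmaps hc, h⟩
      · exact Or.inr ⟨hc, by simpa [sub_eq_zero] using h⟩
    · have h1 : (γ c₀, t₀) = φ (c₀, s₀) := Prod.ext (hγ c₀ hc₀ s₀ hs₀).symm rfl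
      simp only [σ]
      rw [h1, hinv.1 ⟨hc₀, hs₀⟩]
  intro a ha b hb hab
  rw [← hfix a (hsub ha), ← hfix b (hsub hb), hab]

/-! ### The transition map and domain variability -/

variable {ι : Type*} {dC dS d : ℕ} {M : Model ι dC dS d}

theorem Model.isOpen_styleSpace (M : Model ι dC dS d) : IsOpen M.styleSpace :=
  isOpen_iUnion M.isOpen_S

theorem Model.ae_mem (M : Model ι dC dS d) (n : ι) : ∀ᵐ p ∂M.P n, p ∈ M.C ×ˢ M.styleSpace := by
  have h : ∀ᵐ p ∂M.P n, p ∈ M.C ×ˢ M.S n := M.P_compl n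
  filter_upwards [h] with p hp
  exact ⟨hp.1, mem_iUnion.2 ⟨n, hp.2⟩⟩

theorem Model.aemeasurable_g (M : Model ι dC dS d) (n : ι) : AEMeasurable M.g (M.P n) := by
  rw [← Measure.restrict_eq_self_of_ae_mem (M.ae_mem n)]
  exact M.differentiableOn_g.continuousOn.aemeasurable
    (M.isOpen_C.prod M.isOpen_styleSpace).measurableSet

namespace Solution

/-- The map from the true to the learned latent variables. -/
def transition (L : Solution M) (p : E dC × E dS) : E dC × E dS := L.f (M.g p)

variable (L : Solution M)

theorem ae_mem (n : ι) : ∀ᵐ q ∂L.P n, q ∈ L.C ×ˢ L.S := L.P_compl n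

theorem aemeasurable_g (n : ι) : AEMeasurable L.g (L.P n) := by
  rw [← Measure.restrict_eq_self_of_ae_mem (L.ae_mem n)]
  exact L.differentiableOn_g.continuousOn.aemeasurable
    (L.isOpen_C.prod L.isOpen_S).measurableSet

theorem exists_g_eq {p : E dC × E dS} (hp : p ∈ M.C ×ˢ M.styleSpace) :
    ∃ q ∈ L.C ×ˢ L.S, L.g q = M.g p := by
  have h : M.g p ∈ M.dataSpace := mem_image_of_mem _ hp
  rwa [← L.image_g] at h

theorem transition_mem {p : E dC × E dS} (hp : p ∈ M.C ×ˢ M.styleSpace) :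
    L.transition p ∈ L.C ×ˢ L.S := by
  obtain ⟨q, hq, h⟩ := L.exists_g_eq hp
  rw [transition, ← h, L.leftInvOn_f hq]
  exact hq

theorem g_transition {p : E dC × E dS} (hp : p ∈ M.C ×ˢ M.styleSpace) :
    L.g (L.transition p) = M.g p := by
  obtain ⟨q, hq, h⟩ := L.exists_g_eq hp
  rw [transition, ← h, L.leftInvOn_f hq]

theorem bijOn_transition : BijOn L.transition (M.C ×ˢ M.styleSpace) (L.C ×ˢ L.S) := by
  refine ⟨fun p hp => L.transition_mem hp, fun p hp p' hp' h => ?_, fun q hq => ?_⟩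
  · exact M.injOn_g hp hp' (by rw [← L.g_transition hp, ← L.g_transition hp', h])
  · have h : L.g q ∈ M.dataSpace := L.image_g ▸ mem_image_of_mem _ hq
    obtain ⟨p, hp, hpq⟩ := h
    exact ⟨p, hp, by rw [transition, hpq, L.leftInvOn_f hq]⟩

theorem differentiableOn_transition :
    DifferentiableOn ℝ L.transition (M.C ×ˢ M.styleSpace) :=
  L.differentiableOn_f.comp M.differentiableOn_g (mapsTo_image _ _)

/-- The learned content has the same law as the content part of the transition map. -/
theorem measure_transition_fst_preimage (n : ι) {O : Set (E dC)} (hO : MeasurableSet O) :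
    M.P n ((M.C ×ˢ M.styleSpace) ∩ L.transition ⁻¹' (Prod.fst ⁻¹' O)) = L.pc O := by
  -- Distribution matching concerns data, so the event is carried to data space; injectivity of `ĝ`
  -- keeps it measurable.
  let D : Set (E d) := L.g '' ((L.C ×ˢ L.S) ∩ Prod.fst ⁻¹' O)
  have hD : MeasurableSet D :=
    ((L.isOpen_C.prod L.isOpen_S).measurableSet.inter
      (measurable_fst hO)).image_of_continuousOn_injOn
      (L.differentiableOn_g.continuousOn.mono inter_subset_left)
      (L.leftInvOn_f.injOn.mono inter_subset_left)
  have hmem : ∀ q ∈ L.C ×ˢ L.S, (L.g q ∈ D ↔ q.1 ∈ O) := by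
    intro q hq
    constructor
    · rintro ⟨q', ⟨hq', hq'O⟩, h⟩
      rw [← L.leftInvOn_f.injOn hq' hq h]
      exact hq'O
    · intro h
      exact ⟨q, ⟨hq, h⟩, rfl⟩
  have hmatch := congrArg (fun μ => μ D) (L.distribution_matching n)
  simp only [Measure.map_apply_of_aemeasurable (L.aemeasurable_g n) hD,
    Measure.map_apply_of_aemeasurable (M.aemeasurable_g n) hD] at hmatch
  rw [← L.map_fst_P n, Measure.map_apply measurable_fst hO]
  calc _ = M.P n (M.g ⁻¹' D) := by
        refine measure_congr ?_
        filter_upwards [M.ae_mem n] with p hp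
        have h := hmem _ (L.transition_mem hp)
        rw [L.g_transition hp] at h
        exact propext ⟨fun h' => h.2 h'.2, fun h' => ⟨hp, h.1 h'⟩⟩
    _ = L.P n (L.g ⁻¹' D) := hmatch.symm
    _ = L.P n (Prod.fst ⁻¹' O) := by
        refine measure_congr ?_
        filter_upwards [L.ae_mem n] with q hq
        exact propext (hmem q hq)

theorem isOpen_transition_fst_preimage {O : Set (E dC)} (hO : IsOpen O) :
    IsOpen ((M.C ×ˢ M.styleSpace) ∩ L.transition ⁻¹' (Prod.fst ⁻¹' O)) :=
  L.differentiableOn_transition.continuousOn.isOpen_inter_preimage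
    (M.isOpen_C.prod M.isOpen_styleSpace) (hO.preimage continuous_fst)

/-- Under domain variability the learned content does not depend on the style. -/
theorem transition_fst_eq (hM : M.DomainVariability) {c : E dC} (hc : c ∈ M.C) {s s' : E dS}
    (hs : s ∈ M.styleSpace) (hs' : s' ∈ M.styleSpace) :
    (L.transition (c, s)).1 = (L.transition (c, s')).1 := by
  by_contra hne
  obtain ⟨O, O', hO, hO', hsO, hsO', hdisj⟩ := t2_separation hne
  set A := (M.C ×ˢ M.styleSpace) ∩ L.transition ⁻¹' (Prod.fst ⁻¹' O) with hA
  have hAo : IsOpen A := L.isOpen_transition_fst_preimage hO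
  obtain ⟨i, hi⟩ := mem_iUnion.1 hs
  obtain ⟨j, hj⟩ := mem_iUnion.1 hs'
  obtain ⟨U, W, hU, hW, hcU, hsW, hUW⟩ := isOpen_prod_iff.1 hAo c s ⟨⟨hc, hs⟩, hsO⟩
  obtain ⟨U', W', hU', hW', hcU', hsW', hUW'⟩ :=
    isOpen_prod_iff.1 (L.isOpen_transition_fst_preimage hO') c s' ⟨⟨hc, hs'⟩, hsO'⟩
  have hpos : ∀ T : Set (E dC), IsOpen T → c ∈ T → 0 < M.pc T := fun T hT hcT =>
    (Measure.mem_support_iff_forall c).1 (M.C_subset_support hc) T (hT.mem_nhds hcT)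
  have hPA : ∀ n, M.P n A = L.pc O := fun n => L.measure_transition_fst_preimage n hO.measurableSet
  have hAi : 0 < M.P i A :=
    (M.P_pos i U W hU.measurableSet (hpos U hU hcU) hW ⟨s, hsW, hi⟩).trans_le (measure_mono hUW)
  by_cases hB : ∃ B : Set (E dC), B ⊆ M.C ∧ MeasurableSet B ∧
      ∀ n, A =ᵐ[M.P n] (B ×ˢ M.styleSpace : Set (E dC × E dS))
  · obtain ⟨B, -, hBm, hAB⟩ := hB
    -- `B` fills almost all of `U` and almost none of `U'`, although `U ∩ U'` is a charged
    -- neighbourhood of `c`.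
    have h1 : M.pc (U \ B) = 0 := by
      by_contra h
      refine (M.P_pos i _ W (hU.measurableSet.diff hBm) (pos_iff_ne_zero.2 h) hW
        ⟨s, hsW, hi⟩).ne' (measure_mono_null ?_ (ae_le_set.1 (hAB i).le))
      rintro ⟨x, y⟩ ⟨⟨hx, hxB⟩, hy⟩
      exact ⟨hUW ⟨hx, hy⟩, fun h => hxB h.1⟩
    have h2 : M.pc (U' ∩ B) = 0 := by
      by_contra h
      refine (M.P_pos j _ W' (hU'.measurableSet.inter hBm) (pos_iff_ne_zero.2 h) hW'
        ⟨s', hsW', hj⟩).ne' (measure_mono_null ?_ (ae_le_set.1 (hAB j).symm.le))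
      rintro ⟨x, y⟩ ⟨⟨hx, hxB⟩, hy⟩
      have hxy := hUW' (show (x, y) ∈ U' ×ˢ W' from ⟨hx, hy⟩)
      exact ⟨⟨hxB, hxy.1.2⟩, fun h => Set.disjoint_left.1 hdisj h.2 hxy.2⟩
    refine (hpos (U ∩ U') (hU.inter hU') ⟨hcU, hcU'⟩).ne'
      (measure_mono_null ?_ (measure_union_null h1 h2))
    rintro x ⟨hx, hx'⟩
    by_cases h : x ∈ B
    · exact Or.inr ⟨hx', h⟩
    · exact Or.inl ⟨hx, h⟩
  · obtain ⟨k, l, hkl⟩ := hM A inter_subset_left hAo.measurableSet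
      (fun n => by rw [hPA n, ← hPA i]; exact hAi) hB
    exact hkl ((hPA k).trans (hPA l).symm)

/-! ### Derivatives and orthogonality -/

/-- Differentiate `f̂ ∘ ĝ = id`; differentiability of `f̂` along the data space suffices, as `ĝ`
maps into it. -/
theorem injective_fderiv_g {q : E dC × E dS} (hq : q ∈ L.C ×ˢ L.S) :
    Function.Injective (fderiv ℝ L.g q) := by
  have ho := L.isOpen_C.prod L.isOpen_S
  have hg : HasFDerivAt L.g (fderiv ℝ L.g q) q :=
    ((L.differentiableOn_g q hq).differentiableAt (ho.mem_nhds hq)).hasFDerivAt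
  have hmaps : MapsTo L.g (L.C ×ˢ L.S) M.dataSpace := L.image_g ▸ mapsTo_image _ _
  have hf := (L.differentiableOn_f _ (hmaps hq)).hasFDerivWithinAt
  have hid := (hf.comp q hg.hasFDerivWithinAt hmaps).hasFDerivAt (ho.mem_nhds hq)
  have hid' : HasFDerivAt (L.f ∘ L.g) (ContinuousLinearMap.id ℝ _) q := by
    refine (hasFDerivAt_id q).congr_of_eventuallyEq ?_
    filter_upwards [ho.mem_nhds hq] with x hx using L.leftInvOn_f hx
  have h := hid.unique hid'
  intro x y hxy
  have hx := congrArg (fun A => A x) h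
  have hy := congrArg (fun A => A y) h
  simp only [ContinuousLinearMap.comp_apply, ContinuousLinearMap.id_apply] at hx hy
  rw [← hx, ← hy, hxy]

end Solution

theorem contentJacobian_apply {g : E dC × E dS → E d} {c : E dC} {s : E dS}
    (hg : DifferentiableAt ℝ g (c, s)) (v : E dC) :
    contentJacobian g c s v = fderiv ℝ g (c, s) (v, 0) := by
  have h := (hg.hasFDerivAt).comp c (hasFDerivAt_prodMk_left (𝕜 := ℝ) c s)
  have h' : contentJacobian g c s = _ := h.fderiv
  rw [h']
  simp

theorem styleJacobian_apply {g : E dC × E dS → E d} {c : E dC} {s : E dS}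
    (hg : DifferentiableAt ℝ g (c, s)) (w : E dS) :
    styleJacobian g c s w = fderiv ℝ g (c, s) (0, w) := by
  have h := (hg.hasFDerivAt).comp s (hasFDerivAt_prodMk_right (𝕜 := ℝ) c s)
  have h' : styleJacobian g c s = _ := h.fderiv
  rw [h']
  simp

namespace Solution

variable (L : Solution M)

/-- If the learned content does not depend on the style, then differential independence and full
style rank force the content derivative of the learned style to vanish. -/
theorem fderiv_transition_snd_eq_zero (hfst : ∀ c ∈ M.C, ∀ s ∈ M.styleSpace, ∀ s' ∈ M.styleSpace,
      (L.transition (c, s)).1 = (L.transition (c, s')).1)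
    (hI : M.CSDI) (hR : M.FullStyleRank) {n : ι} {c : E dC} (hc : c ∈ M.C) {s : E dS}
    (hs : s ∈ M.S n) : fderiv ℝ (fun c' => (L.transition (c', s)).2) c = 0 := by
  have hs' : s ∈ M.styleSpace := mem_iUnion.2 ⟨n, hs⟩
  have hp : (c, s) ∈ M.C ×ˢ M.styleSpace := ⟨hc, hs'⟩
  have ho := M.isOpen_C.prod M.isOpen_styleSpace
  have hq := L.transition_mem hp
  have hφ := ((L.differentiableOn_transition _ hp).differentiableAt (ho.mem_nhds hp)).hasFDerivAt
  have hĝd := (L.differentiableOn_g _ hq).differentiableAt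
    ((L.isOpen_C.prod L.isOpen_S).mem_nhds hq)
  have hgd : DifferentiableAt ℝ M.g (c, s) :=
    (M.differentiableOn_g _ hp).differentiableAt (ho.mem_nhds hp)
  set T := fderiv ℝ L.transition (c, s)
  set G := fderiv ℝ L.g (L.transition (c, s))
  have hcomp : fderiv ℝ M.g (c, s) = G.comp T := by
    refine ((hĝd.hasFDerivAt.comp (c, s) hφ).congr_of_eventuallyEq ?_).fderiv
    filter_upwards [ho.mem_nhds hp] with p hp' using (L.g_transition hp').symm
  have hT0 : ∀ w : E dS, (T (0, w)).1 = 0 := by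
    have h1 := (hφ.comp s (hasFDerivAt_prodMk_right (𝕜 := ℝ) c s)).fst
    have h2 : HasFDerivAt (fun x => ((L.transition ∘ fun y => (c, y)) x).1)
        (0 : E dS →L[ℝ] E dC) s := by
      refine (hasFDerivAt_const (L.transition (c, s)).1 s).congr_of_eventuallyEq ?_
      filter_upwards [M.isOpen_styleSpace.mem_nhds hs'] with x hx using hfst c hc x hx s hs'
    intro w
    simpa using congrArg (fun A : E dS →L[ℝ] E dC => A w) (h1.unique h2)
  have hTw : ∀ w : E dS, T (0, w) = (0, (T (0, w)).2) := fun w => Prod.ext (hT0 w) rfl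
  let b : E dS →ₗ[ℝ] E dS :=
    (LinearMap.snd ℝ _ _) ∘ₗ T.toLinearMap ∘ₗ LinearMap.inr ℝ (E dC) (E dS)
  have hb : ∀ w, b w = (T (0, w)).2 := fun w => rfl
  have hsty : ∀ w, styleJacobian M.g c s w = G (0, b w) := by
    intro w
    rw [styleJacobian_apply hgd, hcomp, ContinuousLinearMap.comp_apply, hTw w, hb]
  -- `D_s g = G (0, b ·)` has trivial kernel by full rank.
  have hbinj : Function.Injective b := by
    have hker : (styleJacobian M.g c s).toLinearMap.ker = ⊥ := by
      have h1 := (styleJacobian M.g c s).toLinearMap.finrank_range_add_finrank_ker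
      rw [hR n c hc s hs, finrank_euclideanSpace_fin] at h1
      exact Submodule.finrank_eq_zero.1 (by omega)
    intro x y hxy
    refine LinearMap.ker_eq_bot.1 hker ?_
    change styleJacobian M.g c s x = styleJacobian M.g c s y
    rw [hsty, hsty, hxy]
  have hbsurj : Function.Surjective b := LinearMap.surjective_of_injective hbinj
  have hder := (hφ.comp c (hasFDerivAt_prodMk_left (𝕜 := ℝ) c s)).snd
  have hder' : fderiv ℝ (fun c' => (L.transition (c', s)).2) c = _ := hder.fderiv
  rw [hder']
  ext1 v
  change (T (v, 0)).2 = 0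
  -- This `w` makes the true style derivative equal the style part of `D_c g v`; orthogonality then
  -- says that this part has norm zero.
  obtain ⟨w, hw⟩ := hbsurj (T (v, 0)).2
  have hortho := (Submodule.isOrtho_iff_inner_eq.1 (hI n c hc s hs))
    _ (LinearMap.mem_range_self _ v) _ (LinearMap.mem_range_self _ w)
  have hortho' := (Submodule.isOrtho_iff_inner_eq.1 (L.jacobiansOrtho _ hq.1 _ hq.2))
    _ (LinearMap.mem_range_self _ (T (v, 0)).1) _ (LinearMap.mem_range_self _ (T (v, 0)).2)
  change inner ℝ (contentJacobian M.g c s v) (styleJacobian M.g c s w) = 0 at hortho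
  change inner ℝ (contentJacobian L.g (L.transition (c, s)).1 (L.transition (c, s)).2 (T (v, 0)).1)
    (styleJacobian L.g (L.transition (c, s)).1 (L.transition (c, s)).2 (T (v, 0)).2) = 0 at hortho'
  rw [contentJacobian_apply (c := (L.transition (c, s)).1) (s := (L.transition (c, s)).2) hĝd,
    styleJacobian_apply (c := (L.transition (c, s)).1) (s := (L.transition (c, s)).2) hĝd]
    at hortho'
  change inner ℝ (G ((T (v, 0)).1, 0)) (G (0, (T (v, 0)).2)) = 0 at hortho'
  have hsplit : contentJacobian M.g c s v = G ((T (v, 0)).1, 0) + G (0, (T (v, 0)).2) := by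
    rw [contentJacobian_apply hgd, hcomp, ContinuousLinearMap.comp_apply, ← map_add]
    simp
  rw [hsplit, hsty, hw, inner_add_left, hortho', zero_add, inner_self_eq_zero] at hortho
  have h0 := L.injective_fderiv_g hq (hortho.trans (map_zero G).symm)
  exact congrArg Prod.snd h0

end Solution

end ContentStyle

theorem theorem1 {ι : Type*} [Nonempty ι] {dC dS d : ℕ}
    (M : ContentStyle.Model ι dC dS d) (hM : M.DomainVariability)
    (L : ContentStyle.Solution M) :
    (∃ γ : ContentStyle.E dC → ContentStyle.E dC,
      Set.BijOn γ M.C L.C ∧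
      ∀ n, ∀ c ∈ M.C, ∀ s ∈ M.S n, (L.f (M.g (c, s))).1 = γ c) ∧
    (M.CSDI → M.FullStyleRank →
      ∃ δ : ContentStyle.E dS → ContentStyle.E dS,
        Set.BijOn δ M.styleSpace L.S ∧
        ∀ n, ∀ c ∈ M.C, ∀ s ∈ M.S n, (L.f (M.g (c, s))).2 = δ s) := by
  have hmemS : ∀ {n s}, s ∈ M.S n → s ∈ M.styleSpace := fun h => mem_iUnion.2 ⟨_, h⟩
  have hCconn : IsPreconnected M.C :=
    M.isSimplyConnected_C.isPathConnected.isConnected.isPreconnected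
  obtain ⟨c₀, hc₀⟩ := M.isSimplyConnected_C.nonempty
  obtain ⟨n₀⟩ := ‹Nonempty ι›
  obtain ⟨s₀, hs₀'⟩ := (M.isSimplyConnected_S n₀).nonempty
  have hs₀ : s₀ ∈ M.styleSpace := hmemS hs₀'
  have hq₀ := L.transition_mem (show (c₀, s₀) ∈ M.C ×ˢ M.styleSpace from ⟨hc₀, hs₀⟩)
  have hfst : ∀ c ∈ M.C, ∀ s ∈ M.styleSpace, ∀ s' ∈ M.styleSpace,
      (L.transition (c, s)).1 = (L.transition (c, s')).1 :=
    fun c hc s hs s' hs' => L.transition_fst_eq hM hc hs hs'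
  constructor
  · refine ⟨fun c => (L.transition (c, s₀)).1, ⟨fun c hc => ?_, ?_, fun a ha => ?_⟩,
      fun n c hc s hs => hfst c hc s (hmemS hs) s₀ hs₀⟩
    · exact (L.transition_mem (show (c, s₀) ∈ M.C ×ˢ M.styleSpace from ⟨hc, hs₀⟩)).1
    · exact ContentStyle.injOn_of_bijOn_prod M.isOpen_C hCconn M.isOpen_styleSpace
        ⟨s₀, hs₀⟩ L.isOpen_C L.differentiableOn_transition.continuousOn
        L.bijOn_transition
        fun c hc s hs => hfst c hc s hs s₀ hs₀
    · obtain ⟨⟨c, s⟩, ⟨hc, hs⟩, h⟩ := L.bijOn_transition.surjOn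
        (show (a, (L.transition (c₀, s₀)).2) ∈ L.C ×ˢ L.S from ⟨ha, hq₀.2⟩)
      exact ⟨c, hc, (hfst c hc s₀ hs₀ s hs).trans (congrArg Prod.fst h)⟩
  · intro hI hR
    have hsnd : ∀ c ∈ M.C, ∀ s ∈ M.styleSpace,
        (L.transition (c, s)).2 = (L.transition (c₀, s)).2 := by
      intro c hc s hs
      obtain ⟨n, hsn⟩ := mem_iUnion.1 hs
      have hd : DifferentiableOn ℝ (fun c' => (L.transition (c', s)).2) M.C :=
        (L.differentiableOn_transition.comp (t := M.C ×ˢ M.styleSpace) (by fun_prop)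
          fun c' hc' => ⟨hc', hs⟩).snd
      exact M.isOpen_C.is_const_of_fderiv_eq_zero hCconn hd
        (fun c' hc' => L.fderiv_transition_snd_eq_zero hfst hI hR hc' hsn) hc hc₀
    refine ⟨fun s => (L.transition (c₀, s)).2, ⟨fun s hs => ?_, fun s hs s' hs' h => ?_,
      fun a ha => ?_⟩, fun n c hc s hs => hsnd c hc s (hmemS hs)⟩
    · exact (L.transition_mem (show (c₀, s) ∈ M.C ×ˢ M.styleSpace from ⟨hc₀, hs⟩)).2
    -- With the content frozen at `c₀`, the first component is constant, so the second must separate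
    -- styles.
    · have := L.bijOn_transition.injOn (show (c₀, s) ∈ M.C ×ˢ M.styleSpace from ⟨hc₀, hs⟩)
        (show (c₀, s') ∈ M.C ×ˢ M.styleSpace from ⟨hc₀, hs'⟩)
        (Prod.ext (hfst c₀ hc₀ s hs s' hs') h)
      exact congrArg Prod.snd this
    · obtain ⟨⟨c, s⟩, ⟨hc, hs⟩, h⟩ := L.bijOn_transition.surjOn
        (show ((L.transition (c₀, s₀)).1, a) ∈ L.C ×ˢ L.S from ⟨hq₀.1, ha⟩)
      exact ⟨s, hs, (hsnd c hc s hs).symm.trans (congrArg Prod.snd h)⟩
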